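/- Let $a<b$ be odd positive integers. An infinite word over $\{a,b\}$ is a sequence $w=w[0]w[1]w[2]\cdots$ with letters in $\{a,b\}$; infinite words are compared lexicographically. The run-length encoding $\Delta(w)$ is the sequence of lengths of the successive blocks (maximal runs of equal letters) of $w$. The word $w$ is smooth over $\{a,b\}$ if all the iterates $\Delta^k(w)$, $k\ge 0$, are defined and are infinite words over $\{a,b\}$. It is an infinite Lyndon word if it is strictly smaller than each of its proper suffixes $w[k]w[k+1]\cdots$, $k\ge 1$. Then infinite smooth Lyndon words over $\{a,b\}$ exist if and only if $a=1$. Moreover, if $a=1$, there are exactly two of them: the word $m_{\{1<b\}}$ and the word $\Delta^{-1}_1(m_{\{1<b\}})$, where $m_{\{1<b\}}$ is the lexicographically smallest infinite smooth word over $\{1,b\}$ (which exists), and where, for an infinite word $u$ over $\{1,b\}$, $\Delta^{-1}_1(u)=1^{u[0]}\,b^{u[1]}\,1^{u[2]}\,b^{u[3]}\cdots$. -/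

import Mathlib

/-- Infinite words are functions `ℕ → ℕ`. `blockStart w k` is the position at which block number `k`
(numbered from `0`) of the infinite word `w` starts; a block is a maximal run of equal letters.
If block `k` is infinite, there is no next block, and `blockStart w (k + 1) = sInf ∅ = 0`. -/
noncomputable def blockStart (w : ℕ → ℕ) : ℕ → ℕ
  | 0 => 0
  | k + 1 => sInf {n | blockStart w k < n ∧ w n ≠ w (blockStart w k)}

/-- The run-length encoding `Δ`: the letter number `k` of `Δ w` is the length of block number `k`
of `w`. If that block is infinite (so that `Δ w` is not an infinite word over the positive
integers), the value is `0`, which is not a letter of any alphabet of positive integers. -/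
noncomputable def runLength (w : ℕ → ℕ) (k : ℕ) : ℕ :=
  blockStart w (k + 1) - blockStart w k

/-- The pseudo-inverse of the run-length encoding: the word `α^{u 0} β^{u 1} α^{u 2} β^{u 3} ⋯`.
The position `n` lies in the block number `k`, with `k` the least index such that
`n < u 0 + ⋯ + u k`. Over the alphabet `{α, β}` this is `Δ_α⁻¹ u`. -/
noncomputable def runLengthInv (α β : ℕ) (u : ℕ → ℕ) (n : ℕ) : ℕ :=
  if Even (sInf {k | n < ∑ i ∈ Finset.range (k + 1), u i}) then α else β

/-- Infinite smooth words over the alphabet `{a, b}` (with `a`, `b` positive): all iterates of the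
run-length encoding, the word itself included, are infinite words over `{a, b}`. -/
def IsSmooth (a b : ℕ) (w : ℕ → ℕ) : Prop :=
  ∀ k n, runLength^[k] w n = a ∨ runLength^[k] w n = b

/-- Infinite Lyndon words: words lexicographically smaller than all their proper suffixes. -/
def IsInfiniteLyndon (w : ℕ → ℕ) : Prop :=
  ∀ k, 0 < k → toLex w < toLex (fun n => w (n + k))

/-- `m` is the minimal infinite smooth word over `{a, b}` for the lexicographic order. -/
def IsMinimalSmooth (a b : ℕ) (m : ℕ → ℕ) : Prop :=
  IsSmooth a b m ∧ ∀ w, IsSmooth a b w → toLex m ≤ toLex w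

/-! Write Δ_α⁻¹ for `runLengthInv α β`. A longer first block of the small letter makes a word
smaller, a longer second block makes it larger, and so on. Hence Δ_a⁻¹ turns the alternating order
(`AltAt`) into the lexicographic order (`LexAt`). When all block lengths are odd, block n starts at
a position of the parity of n, and so Δ_b⁻¹ turns the lexicographic order into the alternating one.
Over {1, b}, the composite Δ_1⁻¹ ∘ Δ_b⁻¹ (`doubleInv b`) therefore preserves the lexicographic
order. It also lengthens known prefixes, so it has exactly one fixed point m among positive words.

Every comparison with m, or of m with its suffixes, pulls back through the composite to a comparison
at an earlier position. This descent shows that m is minimal (`not_lexAt_of_isSmooth`) and Lyndon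
(`isInfiniteLyndon_of_doubleInv_eq`). For Δ_1⁻¹(m) to be Lyndon, m must precede its even suffixes in
the alternating order. This holds because m has the letter 1 at every even position, so its
differences with such suffixes sit at odd positions, where the two orders agree
(`exists_altAt_of_doubleInv_eq`).

Conversely, a smooth Lyndon word is Δ_a⁻¹(u) with u minimal among its even suffixes (`IsAltMin`). If
u starts with a, then a = 1 and u is a `doubleInv` image of a word of the same kind, whence u = m.
If u starts with b, then again a = 1 and the word is a `doubleInv` image of a smooth Lyndon word
Δ_1⁻¹(x). The case x = m is excluded by an explicit suffix (`not_isAltMin_of_doubleInv_eq`), so x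
starts with b too; the situation reproduces itself and the word is m. -/

/-! ### Blocks and the inverse of run-length encoding -/

/-- The letter of block number `k` in a word whose blocks alternate, starting with `α`. -/
def blockLetter (α β k : ℕ) : ℕ := if Even k then α else β

theorem blockLetter_even {α β k : ℕ} (h : Even k) : blockLetter α β k = α := if_pos h

theorem blockLetter_odd {α β k : ℕ} (h : Odd k) : blockLetter α β k = β :=
  if_neg (Nat.not_even_iff_odd.mpr h)

/-- The length of the first `k` blocks of a word with block lengths `u`. -/
def blockSum (u : ℕ → ℕ) (k : ℕ) : ℕ := ∑ i ∈ Finset.range k, u i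

@[simp] theorem blockSum_zero (u : ℕ → ℕ) : blockSum u 0 = 0 := rfl

theorem blockSum_succ (u : ℕ → ℕ) (k : ℕ) : blockSum u (k + 1) = blockSum u k + u k :=
  Finset.sum_range_succ u k

theorem blockSum_mono (u : ℕ → ℕ) : Monotone (blockSum u) :=
  monotone_nat_of_le_succ fun k => by rw [blockSum_succ]; omega

theorem le_blockSum {u : ℕ → ℕ} (hu : ∀ i, 0 < u i) (k : ℕ) : k ≤ blockSum u k := by
  induction k with
  | zero => simp
  | succ k ih => rw [blockSum_succ]; have := hu k; omega

theorem blockSum_congr {u v : ℕ → ℕ} {n : ℕ} (h : ∀ i < n, u i = v i) :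
    blockSum u n = blockSum v n :=
  Finset.sum_congr rfl fun i hi => h i (Finset.mem_range.mp hi)

theorem even_blockSum {u : ℕ → ℕ} (hu : ∀ i, Odd (u i)) (k : ℕ) : Even (blockSum u k) ↔ Even k := by
  induction k with
  | zero => simp
  | succ k ih =>
    rw [blockSum_succ, Nat.even_add, ih, Nat.even_add_one]
    have := Nat.not_even_iff_odd.mpr (hu k)
    tauto

theorem odd_blockSum {u : ℕ → ℕ} (hu : ∀ i, Odd (u i)) (k : ℕ) : Odd (blockSum u k) ↔ Odd k := by
  rw [← Nat.not_even_iff_odd, ← Nat.not_even_iff_odd, even_blockSum hu]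

theorem exists_eq_blockSum_add {u : ℕ → ℕ} (hu : ∀ i, 0 < u i) (n : ℕ) :
    ∃ k j, j < u k ∧ n = blockSum u k + j := by
  have hex : ∃ k, n < blockSum u (k + 1) := ⟨n, by have := le_blockSum hu (n + 1); omega⟩
  classical
  refine ⟨Nat.find hex, n - blockSum u (Nat.find hex), ?_, ?_⟩
  all_goals
    have h1 := Nat.find_spec hex
    rw [blockSum_succ] at h1
    have h2 : blockSum u (Nat.find hex) ≤ n := by
      rcases h : Nat.find hex with _ | k
      · simp
      · have := Nat.find_min hex (m := k) (by omega)
        omega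
    omega

theorem runLengthInv_blockSum_add {u : ℕ → ℕ} (α β : ℕ) {k j : ℕ}
    (hj : j < u k) : runLengthInv α β u (blockSum u k + j) = blockLetter α β k := by
  have : sInf {k' | blockSum u k + j < ∑ i ∈ Finset.range (k' + 1), u i} = k := by
    apply le_antisymm
    · apply Nat.sInf_le
      change _ < blockSum u (k + 1)
      rw [blockSum_succ]; omega
    · refine le_csInf ⟨k, ?_⟩ fun k' hk' => ?_
      · change _ < blockSum u (k + 1)
        rw [blockSum_succ]; omega
      · change _ < blockSum u (k' + 1) at hk'
        by_contra! hlt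
        have := blockSum_mono u (show k' + 1 ≤ k by omega)
        omega
  unfold runLengthInv blockLetter
  rw [this]

theorem runLengthInv_blockSum {u : ℕ → ℕ} (hu : ∀ i, 0 < u i) (α β k : ℕ) :
    runLengthInv α β u (blockSum u k) = blockLetter α β k :=
  runLengthInv_blockSum_add (j := 0) α β (hu k)

theorem runLengthInv_of_lt {u : ℕ → ℕ} (α β : ℕ) {n : ℕ} (h : n < u 0) :
    runLengthInv α β u n = α := by
  have := runLengthInv_blockSum_add (u := u) (k := 0) α β h
  simpa [blockLetter] using this

theorem runLengthInv_mem (α β : ℕ) (u : ℕ → ℕ) (n : ℕ) :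
    runLengthInv α β u n = α ∨ runLengthInv α β u n = β := by
  unfold runLengthInv; split_ifs <;> simp

theorem blockStart_runLengthInv {u : ℕ → ℕ} (hu : ∀ i, 0 < u i) {α β : ℕ} (hαβ : α ≠ β) (k : ℕ) :
    blockStart (runLengthInv α β u) k = blockSum u k := by
  induction k with
  | zero => rfl
  | succ k ih =>
    rw [blockStart, ih]
    have hne : blockLetter α β (k + 1) ≠ blockLetter α β k := by
      unfold blockLetter
      rcases Nat.even_or_odd k with h | h
      · simp [h, Nat.even_add_one, hαβ.symm]
      · simp [Nat.not_even_iff_odd.mpr h, Nat.even_add_one, hαβ]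
    have hmem : blockSum u (k + 1) ∈ {n | blockSum u k < n ∧
        runLengthInv α β u n ≠ runLengthInv α β u (blockSum u k)} := by
      refine ⟨by rw [blockSum_succ]; have := hu k; omega, ?_⟩
      rwa [runLengthInv_blockSum hu, runLengthInv_blockSum hu]
    apply le_antisymm (Nat.sInf_le hmem)
    refine le_csInf ⟨_, hmem⟩ ?_
    rintro n ⟨h1, h2⟩
    by_contra! hlt
    rw [blockSum_succ] at hlt
    apply h2
    rw [runLengthInv_blockSum hu]
    obtain ⟨j, rfl⟩ := Nat.exists_eq_add_of_lt h1
    rw [add_assoc]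
    exact runLengthInv_blockSum_add α β (by omega)

theorem runLength_runLengthInv {u : ℕ → ℕ} (hu : ∀ i, 0 < u i) {α β : ℕ} (hαβ : α ≠ β) :
    runLength (runLengthInv α β u) = u := by
  funext k
  rw [runLength, blockStart_runLengthInv hu hαβ, blockStart_runLengthInv hu hαβ, blockSum_succ]
  omega

theorem blockSum_runLength {w : ℕ → ℕ} (hw : ∀ k, 0 < runLength w k) (k : ℕ) :
    blockSum (runLength w) k = blockStart w k := by
  induction k with
  | zero => rfl
  | succ k ih =>
    rw [blockSum_succ, ih]
    have := hw k
    unfold runLength at this ⊢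
    omega

theorem runLengthInv_runLength {w : ℕ → ℕ} {a b : ℕ} (hab : ∀ n, w n = a ∨ w n = b)
    (hw0 : w 0 = a) (hw : ∀ k, 0 < runLength w k) :
    runLengthInv a b (runLength w) = w := by
  have hspec : ∀ k, blockStart w k < blockStart w (k + 1) ∧
      w (blockStart w (k + 1)) ≠ w (blockStart w k) := fun k => by
    have hne : {n | blockStart w k < n ∧ w n ≠ w (blockStart w k)}.Nonempty := by
      -- An infinite block would give `sInf ∅ = 0`, hence a truncated difference 0, against
      -- positivity.
      by_contra h
      rw [Set.not_nonempty_iff_eq_empty] at h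
      have := hw k
      rw [runLength, blockStart, h, Nat.sInf_empty] at this
      omega
    exact Nat.sInf_mem hne
  have hletter : ∀ k, w (blockStart w k) = blockLetter a b k := fun k => by
    induction k with
    | zero => exact hw0
    | succ k ih =>
      have h1 := (hspec k).2
      have h2 := hab (blockStart w (k + 1))
      rw [ih] at h1
      rcases Nat.even_or_odd k with h | h
      · rw [blockLetter_even h] at h1
        rw [blockLetter_odd h.add_one]
        tauto
      · rw [blockLetter_odd h] at h1
        rw [blockLetter_even h.add_one]
        tauto
  funext n
  obtain ⟨k, j, hj, rfl⟩ := exists_eq_blockSum_add hw n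
  rw [runLengthInv_blockSum_add a b hj, ← hletter, blockSum_runLength hw]
  by_contra hne
  have : blockStart w (k + 1) ≤ blockStart w k + j :=
    Nat.sInf_le ⟨by rcases j with _ | j; · exact absurd rfl hne
                    · omega, fun h => hne h.symm⟩
  unfold runLength at hj
  omega

/-! ### Suffixes of a decoded word -/

/-- The suffix of `u` starting at `k`, with its first letter decreased by `j`. -/
def trim (u : ℕ → ℕ) (k j i : ℕ) : ℕ := if i = 0 then u k - j else u (i + k)

theorem trim_zero_right (u : ℕ → ℕ) (k : ℕ) : trim u k 0 = fun i => u (i + k) := by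
  funext i
  unfold trim
  split_ifs with h
  · simp [h]
  · rfl

theorem blockSum_trim {u : ℕ → ℕ} {k j : ℕ} (hj : j ≤ u k) (i : ℕ) :
    blockSum (trim u k j) (i + 1) + (blockSum u k + j) = blockSum u (i + 1 + k) := by
  induction i with
  | zero => rw [blockSum_succ, add_comm (0 + 1), ← add_assoc, blockSum_succ]; simp [trim]; omega
  | succ i ih =>
    rw [blockSum_succ, show i + 1 + 1 + k = i + 1 + k + 1 by ring, blockSum_succ u, ← ih]
    have : trim u k j (i + 1) = u (i + 1 + k) := if_neg (by omega)
    omega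

theorem runLengthInv_suffix {u : ℕ → ℕ} (hu : ∀ i, 0 < u i) (α β : ℕ) {k j : ℕ} (hj : j < u k) :
    (fun n => runLengthInv α β u (n + (blockSum u k + j))) =
      runLengthInv (blockLetter α β k) (blockLetter α β (k + 1)) (trim u k j) := by
  have hpos : ∀ i, 0 < trim u k j i := fun i => by
    unfold trim; split_ifs
    · omega
    · exact hu _
  have hl : ∀ i, blockLetter (blockLetter α β k) (blockLetter α β (k + 1)) i =
      blockLetter α β (i + k) := fun i => by
    unfold blockLetter
    simp only [Nat.even_add, Nat.not_even_one]
    split_ifs <;> tauto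
  funext n
  obtain ⟨i, r, hr, rfl⟩ := exists_eq_blockSum_add hpos n
  rw [runLengthInv_blockSum_add _ _ hr, hl]
  rcases i with _ | i
  · simp only [trim, if_pos] at hr
    rw [blockSum_zero, zero_add, zero_add,
      show r + (blockSum u k + j) = blockSum u k + (r + j) by ring]
    exact runLengthInv_blockSum_add α β (by omega)
  · simp only [trim, Nat.add_eq_zero_iff, one_ne_zero, and_false, if_false] at hr
    rw [add_right_comm, blockSum_trim hj.le]
    exact runLengthInv_blockSum_add α β hr

theorem runLengthInv_suffix_even {u : ℕ → ℕ} (hu : ∀ i, 0 < u i) (α β : ℕ) {k j : ℕ}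
    (hj : j < u k) (hk : Even k) :
    (fun n => runLengthInv α β u (n + (blockSum u k + j))) = runLengthInv α β (trim u k j) := by
  rw [runLengthInv_suffix hu α β hj, blockLetter_even hk, blockLetter_odd hk.add_one]

theorem runLengthInv_shift_even {u : ℕ → ℕ} (hu : ∀ i, 0 < u i) (α β : ℕ) {k : ℕ} (hk : Even k) :
    (fun n => runLengthInv α β u (n + blockSum u k)) =
      runLengthInv α β (fun i => u (i + k)) := by
  rw [← trim_zero_right u, ← runLengthInv_suffix_even hu α β (hu k) hk]
  rfl

/-! ### Lexicographic and alternating orders under decoding -/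

/-- `u` and `v` first differ at position `n`, where `u` has the smaller letter. -/
def LexAt (n : ℕ) (u v : ℕ → ℕ) : Prop := (∀ i < n, u i = v i) ∧ u n < v n

/-- `u` and `v` first differ at position `n`, where `u` has the larger letter if `n` is even and the
smaller one if `n` is odd. -/
def AltAt (n : ℕ) (u v : ℕ → ℕ) : Prop :=
  (∀ i < n, u i = v i) ∧ ((Even n ∧ v n < u n) ∨ (Odd n ∧ u n < v n))

theorem toLex_lt_iff {u v : ℕ → ℕ} : toLex u < toLex v ↔ ∃ n, LexAt n u v := Iff.rfl

theorem exists_first_ne {u v : ℕ → ℕ} (h : u ≠ v) : ∃ n, (∀ i < n, u i = v i) ∧ u n ≠ v n := by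
  classical
  have hex : ∃ n, u n ≠ v n := Function.ne_iff.mp h
  exact ⟨Nat.find hex, fun i hi => not_not.mp (Nat.find_min hex hi), Nat.find_spec hex⟩

theorem lexAt_or_lexAt {u v : ℕ → ℕ} (h : u ≠ v) : ∃ n, LexAt n u v ∨ LexAt n v u := by
  obtain ⟨n, h1, h2⟩ := exists_first_ne h
  rcases lt_or_gt_of_ne h2 with h3 | h3
  · exact ⟨n, Or.inl ⟨h1, h3⟩⟩
  · exact ⟨n, Or.inr ⟨fun i hi => (h1 i hi).symm, h3⟩⟩

theorem altAt_or_altAt {u v : ℕ → ℕ} (h : u ≠ v) : ∃ n, AltAt n u v ∨ AltAt n v u := by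
  obtain ⟨n, h1, h2⟩ := exists_first_ne h
  have h1' : ∀ i < n, v i = u i := fun i hi => (h1 i hi).symm
  refine ⟨n, ?_⟩
  unfold AltAt
  rcases Nat.even_or_odd n with hn | hn <;> rcases lt_or_gt_of_ne h2 with h3 | h3 <;> tauto

theorem LexAt.ne {n : ℕ} {u v : ℕ → ℕ} (h : LexAt n u v) : u n ≠ v n := h.2.ne

theorem AltAt.ne {n : ℕ} {u v : ℕ → ℕ} (h : AltAt n u v) : u n ≠ v n := by
  rcases h.2 with h | h
  · exact h.2.ne'
  · exact h.2.ne

theorem eq_of_first_ne {u v : ℕ → ℕ} {n p : ℕ} (hn : ∀ i < n, u i = v i) (hn' : u n ≠ v n)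
    (hp : ∀ i < p, u i = v i) (hp' : u p ≠ v p) : n = p := by
  rcases lt_trichotomy n p with h | h | h
  · exact absurd (hp n h) hn'
  · exact h
  · exact absurd (hn p h) hp'

theorem LexAt.unique {n p : ℕ} {u v : ℕ → ℕ} (h : LexAt n u v) (h' : LexAt p u v) : n = p :=
  eq_of_first_ne h.1 h.ne h'.1 h'.ne

theorem AltAt.unique {n p : ℕ} {u v : ℕ → ℕ} (h : AltAt n u v) (h' : AltAt p u v) : n = p :=
  eq_of_first_ne h.1 h.ne h'.1 h'.ne

theorem LexAt.asymm {n p : ℕ} {u v : ℕ → ℕ} (h : LexAt n u v) (h' : LexAt p v u) : False := by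
  obtain rfl := eq_of_first_ne h.1 h.ne (fun i hi => (h'.1 i hi).symm) h'.ne.symm
  exact h.2.asymm h'.2

theorem AltAt.asymm {n p : ℕ} {u v : ℕ → ℕ} (h : AltAt n u v) (h' : AltAt p v u) : False := by
  obtain rfl := eq_of_first_ne h.1 h.ne (fun i hi => (h'.1 i hi).symm) h'.ne.symm
  rcases h.2 with h | h <;> rcases h'.2 with h' | h'
  · exact h.2.asymm h'.2
  · exact Nat.not_even_iff_odd.mpr h'.1 h.1
  · exact Nat.not_even_iff_odd.mpr h.1 h'.1
  · exact h.2.asymm h'.2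

theorem LexAt.irrefl {n : ℕ} {u : ℕ → ℕ} (h : LexAt n u u) : False := h.ne rfl

theorem AltAt.irrefl {n : ℕ} {u : ℕ → ℕ} (h : AltAt n u u) : False := h.ne rfl

theorem altAt_zero {u v : ℕ → ℕ} (h : v 0 < u 0) : AltAt 0 u v :=
  ⟨fun _ hi => absurd hi (Nat.not_lt_zero _), Or.inl ⟨Even.zero, h⟩⟩

theorem lexAt_zero {u v : ℕ → ℕ} (h : u 0 < v 0) : LexAt 0 u v :=
  ⟨fun _ hi => absurd hi (Nat.not_lt_zero _), h⟩

theorem runLengthInv_agree {u v : ℕ → ℕ} (hu : ∀ i, 0 < u i) (α β : ℕ) {n : ℕ}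
    (h : ∀ i < n, u i = v i) {i : ℕ} (hi : i < blockSum u n) :
    runLengthInv α β u i = runLengthInv α β v i := by
  obtain ⟨k, j, hj, rfl⟩ := exists_eq_blockSum_add hu i
  have hk : k < n := by
    by_contra! hk
    have := blockSum_mono u hk
    omega
  rw [runLengthInv_blockSum_add α β hj, blockSum_congr fun i hi => h i (hi.trans hk),
    runLengthInv_blockSum_add α β (by rwa [← h k hk])]

/-- The decoded words separate exactly where the shorter of the two blocks ends: one has changed
letter, the other has not. -/
theorem runLengthInv_first_ne {u v : ℕ → ℕ} (hu : ∀ i, 0 < u i) (α β : ℕ) {n : ℕ}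
    (h : LexAt n u v) :
    (∀ i < blockSum u n + u n, runLengthInv α β u i = runLengthInv α β v i) ∧
    runLengthInv α β u (blockSum u n + u n) = blockLetter α β (n + 1) ∧
    runLengthInv α β v (blockSum u n + u n) = blockLetter α β n := by
  refine ⟨fun i hi => ?_, ?_, ?_⟩
  · rcases lt_or_ge i (blockSum u n) with hlt | hge
    · exact runLengthInv_agree hu α β h.1 hlt
    · obtain ⟨j, rfl⟩ := Nat.exists_eq_add_of_le hge
      rw [runLengthInv_blockSum_add α β (by omega), blockSum_congr h.1,
        runLengthInv_blockSum_add α β (by have := h.2; omega)]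
  · rw [← blockSum_succ, runLengthInv_blockSum hu]
  · rw [blockSum_congr h.1, runLengthInv_blockSum_add α β h.2]

theorem AltAt.lexAt_runLengthInv {a b : ℕ} (hab : a < b) {u v : ℕ → ℕ} (hu : ∀ i, 0 < u i)
    (hv : ∀ i, 0 < v i) {n : ℕ} (h : AltAt n u v) :
    ∃ p, n < p ∧ LexAt p (runLengthInv a b u) (runLengthInv a b v) := by
  rcases h.2 with ⟨hn, hlt⟩ | ⟨hn, hlt⟩
  · obtain ⟨h1, h2, h3⟩ := runLengthInv_first_ne hv a b (n := n) ⟨fun i hi => (h.1 i hi).symm, hlt⟩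
    refine ⟨_, ?_, fun i hi => (h1 i hi).symm, ?_⟩
    · have := le_blockSum hv n
      have := hv n
      omega
    · rwa [h2, h3, blockLetter_even hn, blockLetter_odd hn.add_one]
  · obtain ⟨h1, h2, h3⟩ := runLengthInv_first_ne hu a b (n := n) ⟨h.1, hlt⟩
    refine ⟨_, ?_, h1, ?_⟩
    · have := le_blockSum hu n
      have := hu n
      omega
    · rwa [h2, h3, blockLetter_odd hn, blockLetter_even hn.add_one]

/-- The images separate at position `blockSum u (n + 1)`, which has the parity of n + 1 because the
letters of u are odd. This parity matches the direction in which the letters differ there. -/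
theorem LexAt.altAt_runLengthInv {a b : ℕ} (hab : a < b) {u v : ℕ → ℕ} (hu : ∀ i, Odd (u i))
    {n : ℕ} (h : LexAt n u v) :
    ∃ p, n < p ∧ (Even p ↔ Odd n) ∧ AltAt p (runLengthInv b a u) (runLengthInv b a v) := by
  have hu' : ∀ i, 0 < u i := fun i => (hu i).pos
  obtain ⟨h1, h2, h3⟩ := runLengthInv_first_ne hu' b a h
  have hpar : Even (blockSum u n + u n) ↔ Odd n := by
    rw [← blockSum_succ, even_blockSum hu, Nat.even_add_one, Nat.not_even_iff_odd]
  refine ⟨_, ?_, hpar, h1, ?_⟩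
  · have := le_blockSum hu' n
    have := hu' n
    omega
  · rw [h2, h3, hpar, ← Nat.not_even_iff_odd (n := blockSum u n + u n), hpar, Nat.not_odd_iff_even]
    rcases Nat.even_or_odd n with hn | hn
    · rw [blockLetter_even hn, blockLetter_odd hn.add_one]
      exact Or.inr ⟨hn, hab⟩
    · rw [blockLetter_odd hn, blockLetter_even hn.add_one]
      exact Or.inl ⟨hn, hab⟩

/-- For even n the images separate at an odd position, where the alternating and lexicographic
orders agree. -/
theorem AltAt.altAt_runLengthInv {a b : ℕ} (hab : a < b) {u v : ℕ → ℕ} (hv : ∀ i, Odd (v i))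
    {n : ℕ} (hn : Even n) (h : AltAt n u v) :
    ∃ p, n < p ∧ AltAt p (runLengthInv a b u) (runLengthInv a b v) := by
  have hv' : ∀ i, 0 < v i := fun i => (hv i).pos
  have hlt : v n < u n := by
    rcases h.2 with h | h
    · exact h.2
    · exact absurd hn (Nat.not_even_iff_odd.mpr h.1)
  obtain ⟨h1, h2, h3⟩ := runLengthInv_first_ne hv' a b (n := n) ⟨fun i hi => (h.1 i hi).symm, hlt⟩
  refine ⟨_, ?_, fun i hi => (h1 i hi).symm, Or.inr ⟨?_, ?_⟩⟩
  · have := le_blockSum hv' n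
    have := hv' n
    omega
  · rw [← blockSum_succ, odd_blockSum hv]
    exact hn.add_one
  · rwa [h2, h3, blockLetter_even hn, blockLetter_odd hn.add_one]

/-- Both orders are total, so the forward implication, applied in both directions, yields the
converse. The strict drop n < p is what makes descent possible. -/
theorem LexAt.altAt_of_runLengthInv {a b : ℕ} (hab : a < b) {u v : ℕ → ℕ} (hu : ∀ i, 0 < u i)
    (hv : ∀ i, 0 < v i) {p : ℕ} (h : LexAt p (runLengthInv a b u) (runLengthInv a b v)) :
    ∃ n, n < p ∧ AltAt n u v := by
  obtain ⟨n, hn | hn⟩ := altAt_or_altAt (u := u) (v := v) (by rintro rfl; exact h.irrefl)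
  · obtain ⟨p', hp', h'⟩ := hn.lexAt_runLengthInv hab hu hv
    obtain rfl := h.unique h'
    exact ⟨n, hp', hn⟩
  · obtain ⟨p', hp', h'⟩ := hn.lexAt_runLengthInv hab hv hu
    exact (h.asymm h').elim

theorem AltAt.lexAt_of_runLengthInv {a b : ℕ} (hab : a < b) {u v : ℕ → ℕ} (hu : ∀ i, Odd (u i))
    (hv : ∀ i, Odd (v i)) {p : ℕ} (h : AltAt p (runLengthInv b a u) (runLengthInv b a v)) :
    ∃ n, n < p ∧ LexAt n u v := by
  obtain ⟨n, hn | hn⟩ := lexAt_or_lexAt (u := u) (v := v) (by rintro rfl; exact h.irrefl)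
  · obtain ⟨p', hp', -, h'⟩ := hn.altAt_runLengthInv hab hu
    obtain rfl := h.unique h'
    exact ⟨n, hp', hn⟩
  · obtain ⟨p', hp', -, h'⟩ := hn.altAt_runLengthInv hab hv
    exact (h.asymm h').elim

/-! ### Smooth words -/

namespace IsSmooth

variable {a b : ℕ} {w : ℕ → ℕ}

theorem mem (h : IsSmooth a b w) (n : ℕ) : w n = a ∨ w n = b := h 0 n

theorem odd (h : IsSmooth a b w) (ha : Odd a) (hb : Odd b) (n : ℕ) : Odd (w n) := by
  rcases h.mem n with h | h <;> rwa [h]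

theorem runLength (h : IsSmooth a b w) : IsSmooth a b (runLength w) := fun k n => h (k + 1) n

theorem symm (h : IsSmooth a b w) : IsSmooth b a w := fun k n => (h k n).symm

theorem exists_eq_runLengthInv (h : IsSmooth a b w) (ha : 0 < a) (hb : 0 < b) (h0 : w 0 = a) :
    ∃ u, IsSmooth a b u ∧ w = runLengthInv a b u := by
  refine ⟨_, h.runLength, (runLengthInv_runLength h.mem h0 fun k => ?_).symm⟩
  rcases h.runLength.mem k with h | h <;> rwa [h]

theorem runLengthInv {u : ℕ → ℕ} (h : IsSmooth a b u) (ha : 0 < a) (hb : 0 < b) (hab : a ≠ b) :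
    IsSmooth a b (runLengthInv a b u) := by
  intro k n
  rcases k with _ | k
  · exact runLengthInv_mem a b u n
  · rw [Function.iterate_succ_apply, runLength_runLengthInv _ hab]
    · exact h k n
    · intro i
      rcases h.mem i with h | h <;> rwa [h]

theorem not_const (h : IsSmooth a b w) (ha : 0 < a) (hb : 0 < b) (hab : a ≠ b) (c : ℕ) :
    ¬ ∀ n, w n = c := by
  wlog h0 : w 0 = a generalizing a b
  · exact this h.symm hb ha hab.symm ((h.mem 0).resolve_left h0)
  intro hc
  obtain ⟨u, hu, rfl⟩ := h.exists_eq_runLengthInv ha hb h0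
  have hpos : ∀ i, 0 < u i := fun i => by rcases hu.mem i with h | h <;> rwa [h]
  have h1 := runLengthInv_blockSum hpos a b 1
  rw [blockLetter_odd odd_one, hc, ← hc 0, h0] at h1
  exact hab h1

end IsSmooth

/-! ### The fixed point of the double inverse and its minimality -/

/-- Two steps of the pseudo-inverse of the run-length encoding over `{1, b}`. -/
noncomputable def doubleInv (b : ℕ) (u : ℕ → ℕ) : ℕ → ℕ := runLengthInv 1 b (runLengthInv b 1 u)

theorem runLengthInv_pos {α β : ℕ} (hα : 0 < α) (hβ : 0 < β) (u : ℕ → ℕ) (n : ℕ) :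
    0 < runLengthInv α β u n := by
  rcases runLengthInv_mem α β u n with h | h <;> rwa [h]

theorem doubleInv_pos {b : ℕ} (hb : 0 < b) (u : ℕ → ℕ) (n : ℕ) : 0 < doubleInv b u n :=
  runLengthInv_pos one_pos hb _ n

/-- One letter is gained because the intermediate word always begins with b > 1, a block length that
exceeds the single letter producing it. -/
theorem doubleInv_agree {b : ℕ} (hb : 1 < b) {u v : ℕ → ℕ} (hu : ∀ i, 0 < u i)
    (hv : ∀ i, 0 < v i) {n : ℕ} (h : ∀ i < n, u i = v i) {i : ℕ} (hi : i < n + 1) :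
    doubleInv b u i = doubleInv b v i := by
  have hpos : ∀ i, 0 < runLengthInv b 1 u i := runLengthInv_pos (by omega) one_pos u
  have h0 : runLengthInv b 1 u 0 = b := runLengthInv_of_lt b 1 (hu 0)
  -- The maximum covers n = 0: the first intermediate letter is b even when nothing is known of u.
  have h1 : ∀ i < max n 1, runLengthInv b 1 u i = runLengthInv b 1 v i := fun i hi => by
    rcases lt_max_iff.mp hi with hi | hi
    · exact runLengthInv_agree hu b 1 h (hi.trans_le (le_blockSum hu n))
    · obtain rfl : i = 0 := by omega
      rw [h0, runLengthInv_of_lt b 1 (hv 0)]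
  have hsum : ∀ k, b + k ≤ blockSum (runLengthInv b 1 u) (k + 1) := fun k => by
    induction k with
    | zero => rw [blockSum_succ, h0]; simp
    | succ k ih => rw [blockSum_succ]; have := hpos (k + 1); omega
  refine runLengthInv_agree hpos 1 b h1 ?_
  have h2 := hsum (max n 1 - 1)
  rw [show max n 1 - 1 + 1 = max n 1 by omega] at h2
  omega

/-- The words generated by a class of words closed under `doubleInv b` preimages agree. -/
theorem eq_of_exists_doubleInv {b : ℕ} (hb : 1 < b) {P : (ℕ → ℕ) → Prop}
    (hP : ∀ w, P w → ∃ v, P v ∧ w = doubleInv b v) {m w : ℕ → ℕ} (hm : doubleInv b m = m)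
    (hw : P w) : w = m := by
  have hpos : ∀ w, P w → ∀ i, 0 < w i := fun w hw => by
    obtain ⟨v, -, rfl⟩ := hP w hw
    exact doubleInv_pos (by omega) v
  have hmpos : ∀ i, 0 < m i := hm ▸ doubleInv_pos (by omega) m
  have key : ∀ n w, P w → ∀ i < n, w i = m i := fun n => by
    induction n with
    | zero => intro _ _ i hi; omega
    | succ n ih =>
      intro w hw i hi
      obtain ⟨v, hv, rfl⟩ := hP w hw
      rw [← hm]
      exact doubleInv_agree hb (hpos v hv) hmpos (ih v hv) hi
  funext i
  exact key (i + 1) w hw i (by omega)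

/-- The iterates on a constant word stabilise letter by letter; the fixed point is their diagonal
limit. -/
theorem exists_doubleInv_eq_self {b : ℕ} (hb : 1 < b) : ∃ m : ℕ → ℕ, doubleInv b m = m := by
  let x : ℕ → ℕ → ℕ := fun n => (doubleInv b)^[n] fun _ => 1
  have hx : ∀ n, x (n + 1) = doubleInv b (x n) := fun n => Function.iterate_succ_apply' _ _ _
  have hpos : ∀ n i, 0 < x n i := fun n i => by
    cases n with
    | zero => exact one_pos
    | succ n => rw [hx]; exact doubleInv_pos (by omega) _ i
  have hstep : ∀ n, ∀ i < n, x n i = x (n + 1) i := fun n => by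
    induction n with
    | zero => intro i hi; omega
    | succ n ih =>
      intro i hi
      rw [hx, hx (n + 1)]
      exact doubleInv_agree hb (hpos _) (hpos _) ih hi
  have hlim : ∀ n, ∀ i < n, x (i + 1) i = x n i := fun n i hi => by
    induction n with
    | zero => omega
    | succ n ih =>
      rcases Nat.lt_succ_iff_lt_or_eq.mp hi with h | rfl
      · rw [ih h, hstep n i h]
      · rfl
  refine ⟨fun i => x (i + 1) i, funext fun i => ?_⟩
  rw [hx]
  exact doubleInv_agree hb (fun i => hpos _ i) (hpos i) (hlim i) (Nat.lt_succ_self i)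

section FixedPoint

variable {b : ℕ} {m : ℕ → ℕ}

theorem doubleInv_head (hb : 0 < b) (u : ℕ → ℕ) : doubleInv b u 0 = 1 :=
  runLengthInv_of_lt 1 b (runLengthInv_pos hb one_pos u 0)

theorem doubleInv_initial {u : ℕ → ℕ} (hu : 0 < u 0) {i : ℕ} (hi : i < b) :
    doubleInv b u i = 1 :=
  runLengthInv_of_lt 1 b (by rwa [runLengthInv_of_lt b 1 hu])

/-- The iterates of Δ on m alternate between m and Δ_b⁻¹(m). -/
theorem isSmooth_of_doubleInv_eq (hb : 1 < b) (hm : doubleInv b m = m) : IsSmooth 1 b m := by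
  have hmpos : ∀ i, 0 < m i := hm ▸ doubleInv_pos (by omega) m
  have h1 : runLength m = runLengthInv b 1 m := by
    conv_lhs => rw [← hm]
    exact runLength_runLengthInv (runLengthInv_pos (by omega) one_pos m) hb.ne
  have h2 : runLength (runLengthInv b 1 m) = m := runLength_runLengthInv hmpos hb.ne'
  have key : ∀ k, runLength^[k] m = m ∨ runLength^[k] m = runLengthInv b 1 m := fun k => by
    induction k with
    | zero => exact Or.inl rfl
    | succ k ih =>
      rw [Function.iterate_succ_apply']
      rcases ih with h | h <;> rw [h]
      · exact Or.inr h1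
      · exact Or.inl h2
  intro k n
  rcases key k with h | h <;> rw [h]
  · rw [← hm]
    exact runLengthInv_mem 1 b _ n
  · exact (runLengthInv_mem b 1 m n).symm

/-- A smaller smooth word must start with 1, and its encoding with b, since Δ(m) starts with the
largest letter. Two decodings then give a smooth word below m with an earlier first difference. -/
theorem not_lexAt_of_isSmooth (hb : 1 < b) (hodd : Odd b) (hm : doubleInv b m = m) (p : ℕ) :
    ∀ w, IsSmooth 1 b w → ¬ LexAt p w m := by
  have hms := isSmooth_of_doubleInv_eq hb hm
  have hmodd := hms.odd odd_one hodd
  have hm0 : m 0 = 1 := by rw [← hm]; exact doubleInv_head (by omega) m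
  have hb0 : 0 < b := by omega
  have hU0 : runLengthInv b 1 m 0 = b := runLengthInv_of_lt b 1 (hmodd 0).pos
  have hUpos := runLengthInv_pos hb0 one_pos m
  induction p using Nat.strong_induction_on with
  | _ p ih =>
  intro w hw h
  have hw0 : w 0 = 1 := by
    rcases Nat.eq_zero_or_pos p with rfl | hp
    · have := h.2
      have := (hw.odd odd_one hodd 0).pos
      omega
    · rw [h.1 0 hp, hm0]
  obtain ⟨u, hu, rfl⟩ := hw.exists_eq_runLengthInv one_pos hb0 hw0
  rw [← hm, doubleInv] at h
  have hupos : ∀ i, 0 < u i := fun i => (hu.odd odd_one hodd i).pos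
  obtain ⟨q, hq, h'⟩ := h.altAt_of_runLengthInv hb hupos hUpos
  rcases hu.mem 0 with hu0 | hu0
  · exact h'.asymm (altAt_zero (by omega))
  · obtain ⟨v, hv, rfl⟩ := hu.symm.exists_eq_runLengthInv hb0 one_pos hu0
    obtain ⟨r, hr, h''⟩ := h'.lexAt_of_runLengthInv hb (hv.symm.odd odd_one hodd) hmodd
    exact ih r (by omega) v hv.symm h''

theorem isMinimalSmooth_of_doubleInv_eq (hb : 1 < b) (hodd : Odd b) (hm : doubleInv b m = m) :
    IsMinimalSmooth 1 b m := by
  refine ⟨isSmooth_of_doubleInv_eq hb hm, fun w hw => ?_⟩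
  rw [← not_lt]
  rintro ⟨p, hp⟩
  exact not_lexAt_of_isSmooth hb hodd hm p w hw hp

end FixedPoint

/-! ### Comparing a decoded word with its suffixes -/

theorem AltAt.head_le {n : ℕ} {u v : ℕ → ℕ} (h : AltAt n u v) : v 0 ≤ u 0 := by
  rcases n with _ | n
  · rcases h.2 with h | h
    · exact h.2.le
    · exact absurd h.1 (by decide)
  · exact (h.1 0 n.succ_pos).symm.le

theorem LexAt.head_le {n : ℕ} {u v : ℕ → ℕ} (h : LexAt n u v) : u 0 ≤ v 0 := by
  rcases n with _ | n
  · exact h.2.le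
  · exact (h.1 0 n.succ_pos).le

theorem trim_pos {u : ℕ → ℕ} (hu : ∀ i, 0 < u i) {k j : ℕ} (hj : j < u k) (i : ℕ) :
    0 < trim u k j i := by
  unfold trim
  split_ifs
  · omega
  · exact hu _

theorem trim_odd {u : ℕ → ℕ} (hu : ∀ i, Odd (u i)) {k j : ℕ} (hj : j < u k) (hje : Even j) (i : ℕ) :
    Odd (trim u k j i) := by
  unfold trim
  split_ifs
  · exact Nat.Odd.sub_even hj.le (hu k) hje
  · exact hu _

theorem trim_apply_zero (u : ℕ → ℕ) (k j : ℕ) : trim u k j 0 = u k - j := rfl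

/-- A suffix starting in a b-block is larger at once. One starting strictly inside an a-block has a
first block shorter than `u 0`, which bounds the letters of u at even positions. Only the starts of
a-blocks need the hypothesis on u. -/
theorem runLengthInv_lexAt_suffix {a b : ℕ} (hab : a < b) {u : ℕ → ℕ} (hu : ∀ i, 0 < u i)
    {k j : ℕ} (hj : j < u k) (hpos : 0 < blockSum u k + j)
    (h : 0 < k → Even k → ∃ n, AltAt n u (fun i => u (i + k))) :
    ∃ n, LexAt n (runLengthInv a b u) (fun i => runLengthInv a b u (i + (blockSum u k + j))) := by
  rcases Nat.even_or_odd k with hk | hk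
  · rw [runLengthInv_suffix_even hu a b hj hk]
    suffices ∃ n, AltAt n u (trim u k j) by
      obtain ⟨n, hn⟩ := this
      obtain ⟨p, -, hp⟩ := hn.lexAt_runLengthInv hab hu (trim_pos hu hj)
      exact ⟨p, hp⟩
    rcases Nat.eq_zero_or_pos j with rfl | hj0
    · rw [trim_zero_right]
      refine h (Nat.pos_of_ne_zero ?_) hk
      rintro rfl
      simp at hpos
    · refine ⟨0, altAt_zero ?_⟩
      have : u k ≤ u 0 := by
        rcases Nat.eq_zero_or_pos k with rfl | hk0
        · rfl
        · obtain ⟨n, hn⟩ := h hk0 hk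
          simpa using hn.head_le
      rw [trim_apply_zero]
      omega
  · refine ⟨0, lexAt_zero ?_⟩
    rw [runLengthInv_of_lt a b (hu 0), zero_add, runLengthInv_blockSum_add a b hj,
      blockLetter_odd hk]
    exact hab

theorem isInfiniteLyndon_runLengthInv {a b : ℕ} (hab : a < b) {u : ℕ → ℕ} (hu : ∀ i, 0 < u i)
    (h : ∀ k, 0 < k → Even k → ∃ n, AltAt n u (fun i => u (i + k))) :
    IsInfiniteLyndon (runLengthInv a b u) := by
  intro p hp
  obtain ⟨k, j, hj, rfl⟩ := exists_eq_blockSum_add hu p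
  exact runLengthInv_lexAt_suffix hab hu hj hp (h k)

theorem runLengthInv_altAt_suffix {b : ℕ} (hb : 1 < b) (hodd : Odd b) {v : ℕ → ℕ}
    (hv : ∀ i, v i = 1 ∨ v i = b) (hv0 : v 0 = 1) (hv1 : v 1 = 1)
    {k j : ℕ} (hj : j < v k) (hpos : 0 < blockSum v k + j) (heven : Even (blockSum v k + j))
    (hnext : Even k → v k = b → v (k + 1) = b)
    (h : 0 < k → ∃ n, LexAt n v (fun i => v (i + k))) :
    ∃ n, AltAt n (runLengthInv b 1 v) (fun i => runLengthInv b 1 v (i + (blockSum v k + j))) := by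
  have hvodd : ∀ i, Odd (v i) := fun i => by
    rcases hv i with h | h <;> rw [h]
    · exact odd_one
    · exact hodd
  have hvpos : ∀ i, 0 < v i := fun i => (hvodd i).pos
  rcases Nat.even_or_odd k with hk | hk
  · rw [runLengthInv_suffix_even hvpos b 1 hj hk]
    suffices ∃ n, LexAt n v (trim v k j) by
      obtain ⟨n, hn⟩ := this
      obtain ⟨p, -, -, hp⟩ := hn.altAt_runLengthInv hb hvodd
      exact ⟨p, hp⟩
    rcases Nat.eq_zero_or_pos j with rfl | hj0
    · rw [trim_zero_right]
      refine h (Nat.pos_of_ne_zero ?_)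
      rintro rfl
      simp at hpos
    · have hvk : v k = b := (hv k).resolve_left (by omega)
      -- If a single letter of the cut block remains, the first letters tie at 1 and the next ones,
      -- 1 against b, decide.
      rcases lt_or_eq_of_le (show 1 ≤ v k - j by omega) with hlt | heq
      · exact ⟨0, lexAt_zero (by rw [hv0, trim_apply_zero]; exact hlt)⟩
      · refine ⟨1, fun i hi => ?_, ?_⟩
        · obtain rfl : i = 0 := by omega
          rw [hv0, trim_apply_zero, heq]
        · have : trim v k j 1 = v (k + 1) := by simp [trim, add_comm]
          rwa [this, hnext hk hvk, hv1]
  · refine ⟨0, altAt_zero ?_⟩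
    rw [runLengthInv_of_lt b 1 (hvpos 0), zero_add, runLengthInv_blockSum_add b 1 hj,
      blockLetter_odd hk]
    exact hb

/-- In a word over `{a, b}` whose blocks have odd lengths and which starts with `a`, a letter `b` at
an even position is followed by a letter `b`. -/
theorem runLengthInv_next {a b : ℕ} (hab : a ≠ b) {u : ℕ → ℕ} (hu : ∀ i, Odd (u i)) {k : ℕ}
    (hk : Even k) (hb : runLengthInv a b u k = b) : runLengthInv a b u (k + 1) = b := by
  obtain ⟨i, j, hj, rfl⟩ := exists_eq_blockSum_add (fun i => (hu i).pos) k
  rw [runLengthInv_blockSum_add a b hj] at hb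
  have hi : Odd i := by
    rw [← Nat.not_even_iff_odd]
    intro h
    rw [blockLetter_even h] at hb
    exact hab hb
  have hj' : Odd j := by
    rw [Nat.even_add', odd_blockSum hu] at hk
    exact hk.mp hi
  have hne : j + 1 ≠ u i := by
    intro h
    exact Nat.not_even_iff_odd.mpr (hu i) (h ▸ hj'.add_one)
  rw [add_assoc, runLengthInv_blockSum_add a b (by omega), blockLetter_odd hi]

theorem lt_blockSum {u : ℕ → ℕ} (hu : ∀ i, 0 < u i) (hu0 : 1 < u 0) {k : ℕ} (hk : 0 < k) :
    k < blockSum u k := by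
  obtain ⟨k, rfl⟩ := Nat.exists_eq_add_of_lt hk
  induction k with
  | zero => rw [zero_add, blockSum_succ]; simpa using hu0
  | succ k ih =>
    rw [blockSum_succ]
    have := hu (0 + (k + 1))
    have := ih (by omega)
    rw [show 0 + (k + 1) = 0 + k + 1 by ring] at *
    omega

/-! ### The two Lyndon words -/

section FixedPoint

variable {b : ℕ} {m : ℕ → ℕ}

theorem isInfiniteLyndon_of_doubleInv_eq (hb : 1 < b) (hodd : Odd b) (hm : doubleInv b m = m) :
    IsInfiniteLyndon m := by
  have hms := isSmooth_of_doubleInv_eq hb hm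
  have hmodd := hms.odd odd_one hodd
  have hmpos : ∀ i, 0 < m i := fun i => (hmodd i).pos
  have hm0 : m 0 = 1 := by rw [← hm]; exact doubleInv_initial (hmpos 0) (by omega)
  have hm1 : m 1 = 1 := by rw [← hm]; exact doubleInv_initial (hmpos 0) hb
  have hUodd : ∀ i, Odd (runLengthInv b 1 m i) := fun i => by
    rcases runLengthInv_mem b 1 m i with h | h <;> rw [h]
    · exact hodd
    · exact odd_one
  have hU0 : runLengthInv b 1 m 0 = b := runLengthInv_of_lt b 1 (hmpos 0)
  have hnext : ∀ k, Even k → m k = b → m (k + 1) = b := fun k hk h => by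
    rw [← hm] at h ⊢
    exact runLengthInv_next hb.ne hUodd hk h
  intro p
  induction p using Nat.strong_induction_on with
  | _ p ih =>
  intro hp
  obtain ⟨k, j, hj, hkj⟩ := exists_eq_blockSum_add (fun i => (hUodd i).pos) p
  have key : ∃ n, LexAt n (doubleInv b m) (fun i => doubleInv b m (i + p)) := by
    rw [hkj] at hp ⊢
    refine runLengthInv_lexAt_suffix hb (fun i => (hUodd i).pos) hj hp fun hk0 hk => ?_
    -- The descent is strict because the first block of m has length b > 1.
    have hlt : k < p := by
      have := lt_blockSum (fun i => (hUodd i).pos) (by rw [hU0]; exact hb) hk0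
      omega
    obtain ⟨l, r, hr, rfl⟩ := exists_eq_blockSum_add hmpos k
    refine runLengthInv_altAt_suffix hb hodd hms.mem hm0 hm1 hr hk0 hk (hnext l) fun hl => ?_
    exact ih l (by have := le_blockSum hmpos l; omega) hl
  rwa [hm] at key

theorem runLengthInv_odd_of_even {b : ℕ} {u : ℕ → ℕ} (hu : ∀ i, Odd (u i)) {n : ℕ}
    (h : ∀ k < n, Even k → u k = 1) {i : ℕ} (hi : Odd i) (hin : i < n) :
    runLengthInv b 1 u i = 1 := by
  obtain ⟨l, r, hr, rfl⟩ := exists_eq_blockSum_add (fun i => (hu i).pos) i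
  rw [runLengthInv_blockSum_add b 1 hr]
  rcases Nat.even_or_odd l with hl | hl
  · have h1 := h l (by have := le_blockSum (fun i => (hu i).pos) l; omega) hl
    obtain rfl : r = 0 := by omega
    exact absurd ((even_blockSum hu l).mpr hl) (Nat.not_even_iff_odd.mpr hi)
  · exact blockLetter_odd hl

/-- If the even letters of m before k are 1, then Δ(m) has the letter 1 at odd indices below k. The
b-blocks of m with such an index are thus single letters, at odd positions, so none of them covers
the even position k. -/
theorem eq_one_of_doubleInv_eq (hb : 1 < b) (hodd : Odd b) (hm : doubleInv b m = m) (k : ℕ)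
    (hk : Even k) : m k = 1 := by
  have hmodd := (isSmooth_of_doubleInv_eq hb hm).odd odd_one hodd
  have hUodd : ∀ i, Odd (runLengthInv b 1 m i) := fun i => by
    rcases runLengthInv_mem b 1 m i with h | h <;> rw [h]
    · exact hodd
    · exact odd_one
  induction k using Nat.strong_induction_on with
  | _ k ih =>
  obtain ⟨i, j, hj, rfl⟩ := exists_eq_blockSum_add (fun i => (hUodd i).pos) k
  have hval := congrFun hm (blockSum (runLengthInv b 1 m) i + j)
  rw [doubleInv, runLengthInv_blockSum_add 1 b hj] at hval
  rw [← hval]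
  rcases Nat.even_or_odd i with hi | hi
  · exact blockLetter_even hi
  · exfalso
    have hle := le_blockSum (fun i => (hUodd i).pos) i
    have hlt : i < blockSum (runLengthInv b 1 m) i + j :=
      lt_of_le_of_ne (by omega) fun h => Nat.not_even_iff_odd.mpr hi (h ▸ hk)
    have h1 := runLengthInv_odd_of_even (b := b) hmodd ih hi hlt
    obtain rfl : j = 0 := by omega
    exact Nat.not_even_iff_odd.mpr ((odd_blockSum hUodd i).mpr hi) hk

/-- Descent as in the Lyndon proof, but the comparison of Δ(m) with its trimmed suffix must occur at
an even index, so that it becomes alternating again after Δ_1⁻¹. -/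
theorem exists_altAt_of_doubleInv_eq (hb : 1 < b) (hodd : Odd b) (hm : doubleInv b m = m) (k : ℕ)
    (hk0 : 0 < k) (hk : Even k) : ∃ n, AltAt n m (fun i => m (i + k)) := by
  have hmodd := (isSmooth_of_doubleInv_eq hb hm).odd odd_one hodd
  have hmpos : ∀ i, 0 < m i := fun i => (hmodd i).pos
  have hUodd : ∀ i, Odd (runLengthInv b 1 m i) := fun i => by
    rcases runLengthInv_mem b 1 m i with h | h <;> rw [h]
    · exact hodd
    · exact odd_one
  have hUpos : ∀ i, 0 < runLengthInv b 1 m i := fun i => (hUodd i).pos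
  have hU0 : runLengthInv b 1 m 0 = b := runLengthInv_of_lt b 1 (hmpos 0)
  have hone := eq_one_of_doubleInv_eq hb hodd hm
  induction k using Nat.strong_induction_on with
  | _ k ih =>
  obtain ⟨i, j, hj, hij⟩ := exists_eq_blockSum_add hUpos k
  have hi : Even i := by
    by_contra hi
    rw [Nat.not_even_iff_odd] at hi
    have h1 := runLengthInv_odd_of_even (b := b) hmodd (fun l (_ : l < i + 1) => hone l) hi
      (Nat.lt_succ_self i)
    obtain rfl : j = 0 := by omega
    exact Nat.not_even_iff_odd.mpr ((odd_blockSum hUodd i).mpr hi) (by rwa [hij] at hk)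
  have hje : Even j := by
    rw [hij, Nat.even_add, even_blockSum hUodd] at hk
    exact hk.mp hi
  suffices key : ∃ n, Even n ∧ AltAt n (runLengthInv b 1 m) (trim (runLengthInv b 1 m) i j) by
    obtain ⟨n, hn, h⟩ := key
    obtain ⟨p, -, hp⟩ := h.altAt_runLengthInv hb (trim_odd hUodd hj hje) hn
    rw [← runLengthInv_suffix_even hUpos 1 b hj hi, ← hij] at hp
    change AltAt p (doubleInv b m) (fun n => doubleInv b m (n + k)) at hp
    rw [hm] at hp
    exact ⟨p, hp⟩
  rcases Nat.eq_zero_or_pos j with rfl | hj0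
  · rw [trim_zero_right]
    have hi0 : 0 < i := Nat.pos_of_ne_zero (by rintro rfl; simp at hij; omega)
    have hik : i < k := by
      have := lt_blockSum hUpos (by rw [hU0]; exact hb) hi0
      omega
    obtain ⟨l, r, hr, rfl⟩ := exists_eq_blockSum_add hmpos i
    rcases Nat.even_or_odd l with hl | hl
    · have hml := hone l hl
      obtain rfl : r = 0 := by omega
      have hl0 : 0 < l := Nat.pos_of_ne_zero (by rintro rfl; simp at hi0)
      obtain ⟨n, hn⟩ := ih l (by have := le_blockSum hmpos l; omega) hl0 hl
      -- At even positions both words have the letter 1, so the difference is at an odd position and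
      -- is lexicographic too.
      have hlex : Odd n ∧ LexAt n m (fun i => m (i + l)) := by
        rcases hn.2 with h | h
        · have h1 := hone n h.1
          have h2 := hone (n + l) (h.1.add hl)
          have h3 := h.2
          simp only [h1, h2] at h3
          omega
        · exact ⟨h.1, hn.1, h.2⟩
      obtain ⟨p, -, hp, h⟩ := hlex.2.altAt_runLengthInv hb hmodd
      refine ⟨p, hp.mpr hlex.1, ?_⟩
      rw [← runLengthInv_shift_even hmpos b 1 hl] at h
      exact h
    · refine ⟨0, Even.zero, altAt_zero ?_⟩
      rw [hU0, zero_add, runLengthInv_blockSum_add b 1 hr, blockLetter_odd hl]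
      exact hb
  · refine ⟨0, Even.zero, altAt_zero ?_⟩
    rw [hU0, trim_apply_zero]
    rcases runLengthInv_mem b 1 m i with h | h <;> omega

end FixedPoint

/-! ### Classification of the smooth Lyndon words -/

/-- `u` precedes all its proper suffixes at even positions for the order in which larger letters are
smaller at even positions. -/
def IsAltMin (u : ℕ → ℕ) : Prop := ∀ k, 0 < k → Even k → ∃ n, AltAt n u (fun i => u (i + k))

theorem IsAltMin.le_head {u : ℕ → ℕ} (h : IsAltMin u) {k : ℕ} (hk : Even k) : u k ≤ u 0 := by
  rcases Nat.eq_zero_or_pos k with rfl | hk0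
  · rfl
  · obtain ⟨n, hn⟩ := h k hk0 hk
    simpa using hn.head_le

/-- Only suffixes starting at an a-block, that is at a block of even index, are compared. -/
theorem IsInfiniteLyndon.isAltMin {a b : ℕ} (hab : a < b) {u : ℕ → ℕ} (hu : ∀ i, 0 < u i)
    (h : IsInfiniteLyndon (runLengthInv a b u)) : IsAltMin u := by
  intro k hk0 hk
  have := le_blockSum hu k
  obtain ⟨p, hp⟩ := toLex_lt_iff.mp (h (blockSum u k) (by omega))
  rw [runLengthInv_shift_even hu a b hk] at hp
  obtain ⟨n, -, hn⟩ := hp.altAt_of_runLengthInv hab hu fun i => hu _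
  exact ⟨n, hn⟩

theorem IsSmooth.pos {a b : ℕ} {u : ℕ → ℕ} (h : IsSmooth a b u) (ha : Odd a) (hb : Odd b) (i : ℕ) :
    0 < u i := (h.odd ha hb i).pos

/-- If `b`, the second letter, does not occur at even positions, then it forms blocks of length
one. -/
theorem eq_one_of_runLengthInv_even {a b : ℕ} (hab : a ≠ b) {v : ℕ → ℕ} (hv : ∀ i, Odd (v i))
    (h : ∀ k, Even k → runLengthInv a b v k = a) {i : ℕ} (hi : Odd i) : v i = 1 := by
  by_contra hne
  have hpos := (hv i).pos
  have h1 := runLengthInv_blockSum_add (u := v) (k := i) (j := 1) a b (by omega)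
  rw [h _ ((odd_blockSum hv i).mpr hi).add_one, blockLetter_odd hi] at h1
  exact hab h1

/-- The first letter bounds those at even positions, so they all equal a. The b-blocks then have
length 1, and 1 must be a letter. -/
theorem IsAltMin.eq_one {a b : ℕ} (hab : a < b) (ha : Odd a) (hb : Odd b) {u : ℕ → ℕ}
    (hu : IsSmooth a b u) (h : IsAltMin u) (h0 : u 0 = a) :
    a = 1 ∧ ∀ k, Even k → u k = a := by
  have heven : ∀ k, Even k → u k = a := fun k hk => by
    have := h.le_head hk
    rcases hu.mem k with h | h <;> omega
  refine ⟨?_, heven⟩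
  obtain ⟨v, hv, rfl⟩ := hu.exists_eq_runLengthInv ha.pos hb.pos h0
  have h1 := eq_one_of_runLengthInv_even hab.ne (hv.odd ha hb) heven odd_one
  have := ha.pos
  rcases hv.mem 1 with h | h <;> omega

theorem IsAltMin.exists_doubleInv {b : ℕ} (hb : 1 < b) (hodd : Odd b) {u : ℕ → ℕ}
    (hu : IsSmooth 1 b u) (heven : ∀ k, Even k → u k = 1) (h : IsAltMin u) :
    ∃ x, (IsSmooth 1 b x ∧ (∀ k, Even k → x k = 1) ∧ IsAltMin x) ∧ u = doubleInv b x := by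
  obtain ⟨v, hv, rfl⟩ := hu.exists_eq_runLengthInv one_pos hodd.pos (heven 0 Even.zero)
  have hvodd := hv.odd odd_one hodd
  have hvpos := hv.pos odd_one hodd
  have hv1 : ∀ i, Odd i → v i = 1 := fun i => eq_one_of_runLengthInv_even hb.ne hvodd heven
  have hvalt : IsAltMin v := by
    intro k hk0 hk
    have hle := le_blockSum hvpos k
    obtain ⟨q, hq⟩ := h (blockSum v k) (by omega) ((even_blockSum hvodd k).mpr hk)
    rw [runLengthInv_shift_even hvpos 1 b hk] at hq
    obtain ⟨n, hn | hn⟩ := altAt_or_altAt (u := v) (v := fun i => v (i + k))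
      fun heq => (by rw [← heq] at hq; exact hq.irrefl)
    · exact ⟨n, hn⟩
    -- The odd letters of v are 1, so a difference in the wrong direction sits at an even index and
    -- would survive decoding.
    · have hne : Even n := by
        by_contra hne
        rw [Nat.not_even_iff_odd] at hne
        apply hn.ne
        rw [hv1 n hne, hv1 (n + k) (hne.add_even hk)]
      obtain ⟨p, -, hp⟩ := hn.altAt_runLengthInv hb hvodd hne
      exact (hp.asymm hq).elim
  have hv0 : v 0 = b := by
    -- Were `v 0 = 1`, the even letters would be at most 1 as well, and v would be constant.
    refine (hv.mem 0).resolve_left fun hv0 => ?_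
    refine hv.not_const one_pos hodd.pos hb.ne 1 fun n => ?_
    rcases Nat.even_or_odd n with hn | hn
    · have := hvalt.le_head hn
      have := hvpos n
      omega
    · exact hv1 n hn
  obtain ⟨x, hx, rfl⟩ := hv.symm.exists_eq_runLengthInv hodd.pos one_pos hv0
  have hxodd := hx.odd hodd odd_one
  have hxpos := hx.pos hodd odd_one
  have hxeven : ∀ k, Even k → x k = 1 := fun k hk => by
    by_contra hne
    have := hxpos k
    have h1 := runLengthInv_blockSum_add (u := x) (k := k) (j := 1) b 1 (by omega)
    rw [hv1 _ ((even_blockSum hxodd k).mpr hk).add_one, blockLetter_even hk] at h1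
    omega
  refine ⟨x, ⟨hx.symm, hxeven, fun k hk0 hk => ?_⟩, rfl⟩
  have hle := le_blockSum hxpos k
  obtain ⟨q, hq⟩ := hvalt (blockSum x k) (by omega) ((even_blockSum hxodd k).mpr hk)
  rw [runLengthInv_shift_even hxpos b 1 hk] at hq
  obtain ⟨n, -, hn⟩ := hq.lexAt_of_runLengthInv hb hxodd fun i => hxodd _
  -- The difference is at an odd index, as even letters are 1; there the lexicographic order is the
  -- alternating one.
  refine ⟨n, hn.1, Or.inr ⟨?_, hn.2⟩⟩
  by_contra hne
  rw [Nat.not_odd_iff_even] at hne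
  apply hn.ne
  rw [hxeven n hne, hxeven (n + k) (hne.add hk)]

theorem IsAltMin.eq_of_head {b : ℕ} (hb : 1 < b) (hodd : Odd b) {m u : ℕ → ℕ}
    (hm : doubleInv b m = m) (hu : IsSmooth 1 b u) (h : IsAltMin u) (h0 : u 0 = 1) : u = m :=
  eq_of_exists_doubleInv hb
    (P := fun w => IsSmooth 1 b w ∧ (∀ k, Even k → w k = 1) ∧ IsAltMin w)
    (fun _ hw => hw.2.2.exists_doubleInv hb hodd hw.1 hw.2.1) hm
    ⟨hu, (h.eq_one hb odd_one hodd hu h0).2, h⟩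

theorem blockSum_of_eq_one {u : ℕ → ℕ} {s k : ℕ} (h : ∀ i < k, u (s + i) = 1) :
    blockSum u (s + k) = blockSum u s + k := by
  induction k with
  | zero => rfl
  | succ k ih =>
    rw [← add_assoc, blockSum_succ, ih fun i hi => h i (by omega), h k (by omega), add_assoc]

theorem doubleInv_values {b : ℕ} (hb : 2 < b) {m : ℕ → ℕ} (hm : doubleInv b m = m) :
    (∀ i < b, m i = 1) ∧ m b = b ∧ ∀ i < b, m (b + 1 + i) = 1 := by
  have hmpos : ∀ i, 0 < m i := hm ▸ doubleInv_pos (by omega) m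
  have h1 : ∀ i < b, m i = 1 := fun i hi => by rw [← hm]; exact doubleInv_initial (hmpos 0) hi
  have hU : ∀ i < b, runLengthInv b 1 m i = blockLetter b 1 i := fun i hi => by
    have hs := blockSum_of_eq_one (u := m) (s := 0) (k := i) fun j hj => h1 _ (by omega)
    simp only [blockSum_zero, zero_add] at hs
    have := runLengthInv_blockSum hmpos b 1 i
    rwa [hs] at this
  have hU0 : runLengthInv b 1 m 0 = b := hU 0 (by omega)
  have hU1 : runLengthInv b 1 m 1 = 1 := hU 1 (by omega)
  have hU2 : runLengthInv b 1 m 2 = b := hU 2 (by omega)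
  have hs1 : blockSum (runLengthInv b 1 m) 1 = b := by simp [blockSum_succ, hU0]
  have hs2 : blockSum (runLengthInv b 1 m) 2 = b + 1 := by simp [blockSum_succ, hU0, hU1]
  refine ⟨h1, ?_, fun i hi => ?_⟩
  · have := runLengthInv_blockSum_add (u := runLengthInv b 1 m) (k := 1) (j := 0) 1 b (by omega)
    rw [hs1] at this
    have hv := congrFun hm (b + 0)
    rw [doubleInv, this] at hv
    exact hv.symm
  · have := runLengthInv_blockSum_add (u := runLengthInv b 1 m) (k := 2) (j := i) 1 b (by omega)
    rw [hs2] at this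
    have hv := congrFun hm (b + 1 + i)
    rw [doubleInv, this] at hv
    exact hv.symm

/-- Since m begins with 1^b b 1^b, the word v = Δ_1⁻¹(m) begins with (1b)^((b-1)/2) 1 b^b followed
by b alternating letters 1b1⋯1. Cutting the next-to-last block length of the run b^b down to 1 gives
a suffix 1b followed by 1b1⋯1, which is lexicographically below v. -/
theorem not_isAltMin_of_doubleInv_eq {b : ℕ} (hb : 2 < b) (hodd : Odd b) {m : ℕ → ℕ}
    (hm : doubleInv b m = m) : ¬ IsAltMin (runLengthInv b 1 (runLengthInv 1 b m)) := by
  intro h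
  have hms := isSmooth_of_doubleInv_eq (by omega) hm
  have hmpos := hms.pos odd_one hodd
  obtain ⟨h1, h2, h3⟩ := doubleInv_values hb hm
  set v := runLengthInv 1 b m with hv
  have hvs : IsSmooth 1 b v := hms.runLengthInv one_pos hodd.pos (by omega)
  have hvodd := hvs.odd odd_one hodd
  have hvpos := hvs.pos odd_one hodd
  have hs1 : ∀ i ≤ b, blockSum m i = i := fun i hi => by
    have hs := blockSum_of_eq_one (u := m) (s := 0) (k := i) fun j hj => h1 _ (by omega)
    simpa only [blockSum_zero, zero_add] using hs
  have hs2 : blockSum m (b + 1) = 2 * b := by rw [blockSum_succ, hs1 b le_rfl, h2]; ring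
  have hs3 : ∀ i ≤ b, blockSum m (b + 1 + i) = 2 * b + i := fun i hi => by
    rw [← hs2]
    exact blockSum_of_eq_one fun j hj => h3 j (by omega)
  have hv1 : ∀ i ≤ b, v i = blockLetter 1 b i := fun i hi => by
    have := runLengthInv_blockSum hmpos 1 b i
    rwa [hs1 i hi] at this
  have hv2 : ∀ j < b, v (b + j) = b := fun j hj => by
    have := runLengthInv_blockSum_add (u := m) (k := b) (j := j) 1 b (by omega)
    rwa [hs1 b le_rfl, blockLetter_odd hodd] at this
  have hv3 : ∀ i ≤ b, v (2 * b + i) = blockLetter 1 b i := fun i hi => by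
    have := runLengthInv_blockSum hmpos 1 b (b + 1 + i)
    rw [hs3 i hi] at this
    rw [hv, this]
    unfold blockLetter
    simp [Nat.even_add, hodd.add_one]
  have hb1 : Even (b - 1) := Nat.Odd.sub_odd hodd odd_one
  have hk : Even (2 * b - 2) := ⟨b - 1, by omega⟩
  have hvk : v (2 * b - 2) = b := by
    rw [show 2 * b - 2 = b + (b - 2) by omega]
    exact hv2 _ (by omega)
  obtain ⟨p, hp⟩ := h (blockSum v (2 * b - 2) + (b - 1)) (by omega)
    (((even_blockSum hvodd _).mpr hk).add hb1)
  have hlt : b - 1 < v (2 * b - 2) := by omega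
  rw [runLengthInv_suffix_even hvpos b 1 hlt hk] at hp
  obtain ⟨n, -, hn⟩ := hp.lexAt_of_runLengthInv (by omega) hvodd (trim_odd hvodd hlt hb1)
  -- At index b + 1 the word v has the second letter of its run b^b, while the cut word still
  -- alternates and has 1.
  refine hn.asymm (p := b + 1) ⟨fun i hi => ?_, ?_⟩
  · rcases i with _ | _ | i
    · rw [trim_apply_zero, hvk, hv1 0 (by omega), blockLetter_even Even.zero]
      omega
    · change v (0 + 1 + (2 * b - 2)) = v 1
      rw [show 0 + 1 + (2 * b - 2) = b + (b - 1) by omega, hv2 _ (by omega), hv1 1 (by omega),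
        blockLetter_odd odd_one]
    · change v (i + 1 + 1 + (2 * b - 2)) = v (i + 1 + 1)
      rw [show i + 1 + 1 + (2 * b - 2) = 2 * b + i by omega, hv3 i (by omega),
        hv1 _ (by omega)]
      unfold blockLetter
      simp [Nat.even_add_one]
  · change v (b + 1 + (2 * b - 2)) < v (b + 1)
    rw [show b + 1 + (2 * b - 2) = 2 * b + (b - 1) by omega, hv3 _ (by omega), hv2 1 (by omega),
      blockLetter_even hb1]
    omega

/-- If the first b-block were longer than 1, the even suffix at its last letter would begin with ba
and precede u, which begins with bb. So 1 is a letter, and minimality of u descends to the Lyndon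
property of v. -/
theorem IsAltMin.exists_isInfiniteLyndon {a b : ℕ} (hab : a < b) (ha : Odd a) (hb : Odd b)
    {u : ℕ → ℕ} (hu : IsSmooth a b u) (h : IsAltMin u) (h0 : u 0 = b) :
    a = 1 ∧ ∃ x, IsSmooth a b x ∧ u = runLengthInv b a (runLengthInv a b x) ∧
      IsInfiniteLyndon (runLengthInv a b x) := by
  obtain ⟨v, hv, rfl⟩ := hu.symm.exists_eq_runLengthInv hb.pos ha.pos h0
  replace hv := hv.symm
  have hvodd := hv.odd ha hb
  have hvpos := hv.pos ha hb
  have hv0 : v 0 = 1 := by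
    by_contra hne
    have hpos := hvpos 0
    have hs1 : blockSum v 1 = v 0 := by simp [blockSum_succ]
    have h1 := runLengthInv_blockSum hvpos b a 1
    rw [hs1, blockLetter_odd odd_one] at h1
    obtain ⟨n, hn⟩ := h (v 0 - 1) (by omega) (Nat.Odd.sub_odd (hvodd 0) odd_one)
    refine hn.asymm (p := 1) ⟨fun i hi => ?_, Or.inr ⟨odd_one, ?_⟩⟩
    · obtain rfl : i = 0 := by omega
      change runLengthInv b a v (0 + (v 0 - 1)) = _
      rw [runLengthInv_of_lt b a (by omega), runLengthInv_of_lt b a (by omega)]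
    · change runLengthInv b a v (1 + (v 0 - 1)) < _
      rw [show 1 + (v 0 - 1) = v 0 by omega, h1, runLengthInv_of_lt b a (by omega)]
      exact hab
  have ha1 : a = 1 := by
    have := ha.pos
    rcases hv.mem 0 with h | h <;> omega
  refine ⟨ha1, ?_⟩
  obtain ⟨x, hx, rfl⟩ := hv.exists_eq_runLengthInv ha.pos hb.pos (hv0.trans ha1.symm)
  refine ⟨x, hx, rfl, ?_⟩
  have hxodd := hx.odd ha hb
  have hxpos := hx.pos ha hb
  have heven : ∀ k, 0 < k → Even k → toLex (runLengthInv a b x) <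
      toLex fun n => runLengthInv a b x (n + k) := fun k hk0 hk => by
    have hle := le_blockSum hvpos k
    obtain ⟨q, hq⟩ := h (blockSum (runLengthInv a b x) k) (by omega)
      ((even_blockSum hvodd k).mpr hk)
    rw [runLengthInv_shift_even hvpos b a hk] at hq
    obtain ⟨n, -, hn⟩ := hq.lexAt_of_runLengthInv hab hvodd fun i => hvodd _
    exact ⟨n, hn⟩
  intro k hk0
  rcases Nat.even_or_odd k with hk | hk
  · exact heven k hk0 hk
  -- Minimality of u only reaches even shifts. An odd shift falls either in a b-block, or strictly
  -- inside an a-block, where it exceeds the suffix from the start of that block, itself an even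
  -- shift.
  · obtain ⟨i, j, hj, rfl⟩ := exists_eq_blockSum_add hxpos k
    rcases Nat.even_or_odd i with hi | hi
    · have hj0 : 0 < j := by
        rw [Nat.odd_add, odd_blockSum hxodd] at hk
        refine Nat.pos_of_ne_zero ?_
        rintro rfl
        exact Nat.not_even_iff_odd.mpr (hk.mpr Even.zero) hi
      have halt : AltAt 0 (fun n => x (n + i)) (trim x i j) := altAt_zero (by
        rw [trim_apply_zero, zero_add]
        omega)
      obtain ⟨p, -, hp⟩ := halt.lexAt_runLengthInv hab (fun n => hxpos _) (trim_pos hxpos hj)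
      rw [← runLengthInv_suffix_even hxpos a b hj hi, ← runLengthInv_shift_even hxpos a b hi] at hp
      have hlt := toLex_lt_iff.mpr ⟨p, hp⟩
      rcases Nat.eq_zero_or_pos i with rfl | hi0
      · exact hlt
      · have hle := le_blockSum hxpos i
        exact (heven _ (by omega) ((even_blockSum hxodd i).mpr hi)).trans hlt
    · refine toLex_lt_iff.mpr ⟨0, lexAt_zero ?_⟩
      rw [zero_add, runLengthInv_blockSum_add a b hj, blockLetter_odd hi, hv0, ← ha1]
      exact hab

theorem IsInfiniteLyndon.exists_eq_runLengthInv {a b : ℕ} (hab : a < b) (ha : Odd a) (hb : Odd b)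
    {w : ℕ → ℕ} (hw : IsSmooth a b w) (h : IsInfiniteLyndon w) :
    ∃ u, IsSmooth a b u ∧ w = runLengthInv a b u ∧ IsAltMin u := by
  have hw0 : w 0 = a := by
    by_contra hw0
    refine hw.not_const ha.pos hb.pos hab.ne b fun n => ?_
    rw [(hw.mem 0).resolve_left hw0 |>.symm]
    rcases Nat.eq_zero_or_pos n with rfl | hn
    · rfl
    · obtain ⟨p, hp⟩ := toLex_lt_iff.mp (h n hn)
      have hle := hp.head_le
      simp only [zero_add] at hle
      rcases hw.mem n with h | h <;> rcases hw.mem 0 with h' | h' <;> omega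
  obtain ⟨u, hu, rfl⟩ := hw.exists_eq_runLengthInv ha.pos hb.pos hw0
  exact ⟨u, hu, rfl, h.isAltMin hab (hu.pos ha hb)⟩

theorem IsInfiniteLyndon.eq_one {a b : ℕ} (hab : a < b) (ha : Odd a) (hb : Odd b)
    {w : ℕ → ℕ} (hw : IsSmooth a b w) (h : IsInfiniteLyndon w) : a = 1 := by
  obtain ⟨u, hu, rfl, hmin⟩ := h.exists_eq_runLengthInv hab ha hb hw
  rcases hu.mem 0 with h0 | h0
  · exact (hmin.eq_one hab ha hb hu h0).1
  · exact (hmin.exists_isInfiniteLyndon hab ha hb hu h0).1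

theorem IsInfiniteLyndon.eq_or_eq {b : ℕ} (hb : 1 < b) (hodd : Odd b) {m w : ℕ → ℕ}
    (hm : doubleInv b m = m) (hw : IsSmooth 1 b w) (h : IsInfiniteLyndon w) :
    w = m ∨ w = runLengthInv 1 b m := by
  have hb2 : 2 < b := by
    obtain ⟨c, rfl⟩ := hodd
    omega
  obtain ⟨u, hu, rfl, hmin⟩ := h.exists_eq_runLengthInv hb odd_one hodd hw
  rcases hu.mem 0 with h0 | h0
  · exact Or.inr (by rw [hmin.eq_of_head hb hodd hm hu h0])
  · left
    -- The condition `u 0 = b` belongs to the invariant: its failure one level down would force x =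
    -- m, which is impossible.
    refine eq_of_exists_doubleInv hb (P := fun w => ∃ u, w = runLengthInv 1 b u ∧
      IsSmooth 1 b u ∧ IsAltMin u ∧ u 0 = b) ?_ hm ⟨u, rfl, hu, hmin, h0⟩
    rintro _ ⟨u, rfl, hu, hmin, h0⟩
    obtain ⟨-, x, hx, rfl, hlyn⟩ := hmin.exists_isInfiniteLyndon hb odd_one hodd hu h0
    have hxmin := hlyn.isAltMin hb (hx.pos odd_one hodd)
    refine ⟨_, ⟨x, rfl, hx, hxmin, (hx.mem 0).resolve_left fun hx0 => ?_⟩, rfl⟩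
    obtain rfl := hxmin.eq_of_head hb hodd hm hx hx0
    exact not_isAltMin_of_doubleInv_eq hb2 hodd hm hmin

theorem theorem21 (a b : ℕ) (hab : a < b) (ha : Odd a) (hb : Odd b) :
    ((∃ w : ℕ → ℕ, IsSmooth a b w ∧ IsInfiniteLyndon w) ↔ a = 1) ∧
    (a = 1 → ∃ m : ℕ → ℕ, IsMinimalSmooth 1 b m ∧ m ≠ runLengthInv 1 b m ∧
      {w : ℕ → ℕ | IsSmooth 1 b w ∧ IsInfiniteLyndon w} = {m, runLengthInv 1 b m}) := by
  have hb1 : 1 < b := by have := ha.pos; omega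
  obtain ⟨m, hm⟩ := exists_doubleInv_eq_self hb1
  have hms := isSmooth_of_doubleInv_eq hb1 hm
  have hmpos := hms.pos odd_one hb
  have hlyn := isInfiniteLyndon_of_doubleInv_eq hb1 hb hm
  refine ⟨⟨fun ⟨w, hw, h⟩ => h.eq_one hab ha hb hw, ?_⟩, fun _ => ⟨m, ?_, ?_, ?_⟩⟩
  · rintro rfl
    exact ⟨m, hms, hlyn⟩
  · exact isMinimalSmooth_of_doubleInv_eq hb1 hb hm
  -- The word m begins with 11, whereas its decoding begins with 1b because `m 0 = 1`.
  · intro h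
    have hm1 : m 1 = 1 := by rw [← hm]; exact doubleInv_initial (hmpos 0) hb1
    have hs1 : blockSum m 1 = 1 := by
      have : m 0 = 1 := by rw [← hm]; exact doubleInv_initial (hmpos 0) hb.pos
      simp [blockSum_succ, this]
    have h1 := runLengthInv_blockSum hmpos 1 b 1
    rw [hs1, ← h, hm1, blockLetter_odd odd_one] at h1
    omega
  · ext w
    constructor
    · rintro ⟨hw, h⟩
      exact h.eq_or_eq hb1 hb hm hw
    · rintro (rfl | rfl)
      · exact ⟨hms, hlyn⟩
      · exact ⟨hms.runLengthInv one_pos hb.pos hb1.ne,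
          isInfiniteLyndon_runLengthInv hb1 hmpos (exists_altAt_of_doubleInv_eq hb1 hb hm)⟩
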